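/- Let $k$ be a field that is complete with respect to a non-Archimedean absolute value $|\cdot|\colon k\to\mathbb{R}_{\ge 0}$ whose image $|k|$ is dense in $\mathbb{R}_{\ge 0}$. A Banach $k$-vector space is a complete ultrametric normed $k$-vector space, and two of them are called isomorphic if there is an isometric $k$-linear isomorphism between them. For a family $W=(W_i)_{i\in I}$ of Banach $k$-vector spaces, the bounded direct product $\Pi_I W$ is the space of all families $(w_i)_{i\in I}$ with $w_i\in W_i$ and $\sup_{i}\|w_i\|<\infty$, equipped with the supremum norm, and the completed direct sum $\Sigma_I W\subset\Pi_I W$ is the closed subspace of those $(w_i)_{i \in I}$ for which $\{i\in I : \|w_i\|\ge\epsilon\}$ is finite for every $\epsilon>0$. Let $\kappa$ be either an infinite cardinal or the class of all cardinals, in which case every set is regarded as having cardinality less than $\kappa$. Let $\mathscr{R}_0$ be the class of Banach $k$-vector spaces isomorphic to $k^d$ with the maximum norm for some integer $d\ge 0$. For an ordinal $\alpha>0$, let $\mathscr{R}_\alpha$ be the class of all Banach $k$-vector spaces that belong to $\mathscr{R}_0$ or are isomorphic to $\Pi_I W$ or to $\Sigma_I W$ for some set $I$ of cardinality less than $\kappa$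 and some family $W=(W_i)_{i\in I}$ with $W_i\in\bigcup_{\beta<\alpha}\mathscr{R}_\beta$ for all $i\in I$. Put $\mathscr{R}=\bigcup_\alpha\mathscr{R}_\alpha$, where $\alpha$ runs through all ordinals; equivalently, $\mathscr{R}$ is the smallest class of Banach $k$-vector spaces that contains $k$ and is closed under isomorphisms and under bounded direct products and completed direct sums over index sets of cardinality less than $\kappa$. Call a set $X$ $\omega_1$-measurable if it is uncountable and carries a non-principal ultrafilter that is closed under countable intersections. Assume that no set of cardinality less than $\kappa$ is $\omega_1$-measurable. Then the Banach $k$-vector space $\mathrm{C}_{\mathrm{bd}}(\mathbb{Q},k)$ of bounded continuous functions $\mathbb{Q}\to k$ ($\mathbb{Q}$ with its usual topology), equipped with the supremum norm, does not belong to $\mathscr{R}$. -/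

import Mathlib

open scoped ENNReal NNReal BoundedContinuousFunction

universe u

/-! ### Ultrametric Banach spaces -/

/-- A Banach space over the valued field `k`: a complete ultrametric normed `k`-vector space. -/
structure BanachObj (k : Type u) [NormedField k] where
  carrier : Type u
  [normedAddCommGroup : NormedAddCommGroup carrier]
  [normedSpace : NormedSpace k carrier]
  [isUltrametricDist : IsUltrametricDist carrier]
  [completeSpace : CompleteSpace carrier]

namespace BanachObj

variable {k : Type u} [NormedField k]

instance : CoeSort (BanachObj k) (Type u) := ⟨BanachObj.carrier⟩

attribute [instance] BanachObj.normedAddCommGroup BanachObj.normedSpace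
  BanachObj.isUltrametricDist BanachObj.completeSpace

/-- `V ≅ W` in the category whose morphisms are the `k`-linear maps of operator norm at most one:
an isometric `k`-linear isomorphism. -/
def Iso (V W : BanachObj k) : Prop := Nonempty (V ≃ₗᵢ[k] W)

theorem Iso.refl (V : BanachObj k) : V.Iso V := ⟨LinearIsometryEquiv.refl k V⟩

theorem Iso.trans {U V W : BanachObj k} : U.Iso V → V.Iso W → U.Iso W :=
  fun ⟨e⟩ ⟨f⟩ => ⟨e.trans f⟩

/-! ### Bounded direct products and completed direct sums -/

theorem lp_isUltrametricDist {I : Type u} (W : I → BanachObj k) :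
    IsUltrametricDist (lp (fun i => (W i : Type u)) ∞) := by
  refine IsUltrametricDist.isUltrametricDist_of_forall_norm_add_le_max_norm fun f g => ?_
  refine lp.norm_le_of_forall_le (le_max_of_le_left (norm_nonneg f)) fun i => ?_
  refine (IsUltrametricDist.norm_add_le_max (f i) (g i)).trans ?_
  exact max_le_max (lp.norm_apply_le_norm ENNReal.top_ne_zero f i)
    (lp.norm_apply_le_norm ENNReal.top_ne_zero g i)

/-- The bounded direct product: all families `w` with `w i ∈ W i` and `sup ‖w i‖ < ∞`,
with the supremum norm. -/
noncomputable def boundedProd {I : Type u} (W : I → BanachObj k) : BanachObj k :=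
  haveI := lp_isUltrametricDist W
  { carrier := lp (fun i => (W i : Type u)) ∞ }

/-- The subspace of the bounded direct product consisting of all `w` such that
`{i | ε ≤ ‖w i‖}` is finite for every `ε > 0`. -/
def nullSubmodule {I : Type u} (W : I → BanachObj k) :
    Submodule k (lp (fun i => (W i : Type u)) ∞) where
  carrier := {w | ∀ ε : ℝ, 0 < ε → {i | ε ≤ ‖w i‖}.Finite}
  zero_mem' := fun ε hε => by
    refine Set.Finite.subset Set.finite_empty fun i hi => ?_
    have h : ε ≤ ‖(0 : W i)‖ := hi
    rw [norm_zero] at h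
    exact absurd hε (not_lt.mpr h)
  add_mem' := fun {v w} hv hw ε hε => by
    refine ((hv ε hε).union (hw ε hε)).subset fun i hi => ?_
    have h : ε ≤ ‖v i + w i‖ := hi
    exact le_max_iff.mp (h.trans (IsUltrametricDist.norm_add_le_max (v i) (w i)))
  smul_mem' := fun c w hw ε hε => by
    by_cases hc : c = 0
    · refine Set.Finite.subset Set.finite_empty fun i hi => ?_
      have h : ε ≤ ‖c • w i‖ := hi
      rw [hc, zero_smul, norm_zero] at h
      exact absurd hε (not_lt.mpr h)
    · have hc' : 0 < ‖c‖ := norm_pos_iff.mpr hc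
      refine (hw (ε / ‖c‖) (div_pos hε hc')).subset fun i hi => ?_
      have h : ε ≤ ‖c • w i‖ := hi
      rw [norm_smul] at h
      exact (div_le_iff₀' hc').mpr h

theorem isClosed_nullSubmodule {I : Type u} (W : I → BanachObj k) :
    IsClosed (nullSubmodule W : Set (lp (fun i => (W i : Type u)) ∞)) := by
  refine isClosed_of_closure_subset fun w hw ε hε => ?_
  obtain ⟨v, hv, hvw⟩ := Metric.mem_closure_iff.mp hw ε hε
  refine (hv ε hε).subset fun i hi => ?_
  have h : ε ≤ ‖w i‖ := hi
  have h1 : ‖w i - v i‖ < ε := by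
    have := lp.norm_apply_le_norm ENNReal.top_ne_zero (w - v) i
    rw [dist_eq_norm] at hvw
    exact lt_of_le_of_lt this hvw
  have h2 : ‖w i‖ ≤ max ‖w i - v i‖ ‖v i‖ := by
    simpa using IsUltrametricDist.norm_add_le_max (w i - v i) (v i)
  rcases le_max_iff.mp (h.trans h2) with h3 | h3
  · exact absurd h1 (not_lt.mpr h3)
  · exact h3

/-- The completed direct sum: the closed subspace of the bounded direct product consisting of
the families that tend to `0`. -/
noncomputable def completedSum {I : Type u} (W : I → BanachObj k) : BanachObj k :=
  haveI := lp_isUltrametricDist W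
  haveI : CompleteSpace (nullSubmodule W) :=
    (isClosed_nullSubmodule W).completeSpace_coe
  haveI : IsUltrametricDist (nullSubmodule W) :=
    ⟨fun x y z => IsUltrametricDist.dist_triangle_max (x : lp (fun i => (W i : Type u)) ∞) y z⟩
  { carrier := nullSubmodule W }

/-! ### Bounded continuous functions -/

theorem bcf_isUltrametricDist [IsUltrametricDist k] (X : Type) [TopologicalSpace X] : IsUltrametricDist (X →ᵇ k) := by
  refine IsUltrametricDist.isUltrametricDist_of_forall_norm_add_le_max_norm fun f g => ?_
  refine (BoundedContinuousFunction.norm_le (le_max_of_le_left (norm_nonneg f))).mpr fun x => ?_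
  refine (IsUltrametricDist.norm_add_le_max (f x) (g x)).trans ?_
  exact max_le_max (f.norm_coe_le_norm x) (g.norm_coe_le_norm x)

variable [IsUltrametricDist k] [CompleteSpace k]

variable (k) in
/-- The space of bounded continuous functions `X → k` with the supremum norm. -/
noncomputable def Cbd (X : Type) [TopologicalSpace X] : BanachObj k :=
  haveI := bcf_isUltrametricDist (k := k) X
  { carrier := X →ᵇ k }

variable (k) in
/-- The one-dimensional space `k`. -/
def base : BanachObj k := { carrier := k }

/-! ### The Reid class -/

variable (k) in
/-- The spaces isomorphic to `k ^ d` with the maximum norm, for some natural number `d`. -/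
def finFree : Set (BanachObj k) := {V | ∃ d : ℕ, Nonempty (V ≃ₗᵢ[k] (Fin d → k))}

variable (k) in
/-- The `α`-th stage of the Reid hierarchy with respect to `κ`. It consists of the spaces
isomorphic to some `k ^ d` and of the spaces isomorphic to the bounded direct product or to the
completed direct sum of a family of spaces of earlier stages whose index set has cardinality
less than `κ`. The value `κ = ⊤` puts no bound on the index sets. -/
def reidStage (κ : WithTop Cardinal.{u}) (α : Ordinal.{u}) : Set (BanachObj k) :=
  finFree k ∪
    {V | ∃ I : Type u, (Cardinal.mk I : WithTop Cardinal.{u}) < κ ∧ ∃ W : I → BanachObj k,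
      (∀ i, ∃ β, ∃ _ : β < α, W i ∈ reidStage κ β) ∧
        (V.Iso (boundedProd W) ∨ V.Iso (completedSum W))}
  termination_by α

variable (k) in
/-- The Reid class of Banach spaces over `k` with respect to `κ`. -/
def reidClass (κ : WithTop Cardinal.{u}) : Set (BanachObj k) := ⋃ α, reidStage k κ α

/-- Closure of a class of Banach spaces under isomorphisms and under bounded direct products and
completed direct sums with fewer than `κ` terms. -/
structure IsReidClosed (κ : WithTop Cardinal.{u}) (C : Set (BanachObj k)) : Prop where
  base_mem : base k ∈ C
  iso_mem : ∀ V W : BanachObj k, V.Iso W → W ∈ C → V ∈ C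
  prod_mem : ∀ (I : Type u) (W : I → BanachObj k), (Cardinal.mk I : WithTop Cardinal.{u}) < κ →
    (∀ i, W i ∈ C) → boundedProd W ∈ C
  sum_mem : ∀ (I : Type u) (W : I → BanachObj k), (Cardinal.mk I : WithTop Cardinal.{u}) < κ →
    (∀ i, W i ∈ C) → completedSum W ∈ C

theorem finFree_subset_of_isReidClosed {κ : WithTop Cardinal.{u}}
    (hκ : (Cardinal.aleph0 : Cardinal.{u}) ≤ κ) {C : Set (BanachObj k)} (hC : IsReidClosed κ C) :
    finFree k ⊆ C := by
  rintro V ⟨d, ⟨e⟩⟩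
  have hmem : boundedProd (fun _ : ULift.{u} (Fin d) => base k) ∈ C := by
    refine hC.prod_mem _ _ (lt_of_lt_of_le ?_ hκ) fun _ => hC.base_mem
    exact WithTop.coe_lt_coe.mpr (Cardinal.lt_aleph0_of_finite _)
  let L : (Fin d → k) ≃ₗ[k] lp (fun _ : ULift.{u} (Fin d) => (base k : Type u)) ∞ :=
    { toFun := fun x => ⟨fun i => x i.down, memℓp_infty (Set.finite_range _).bddAbove⟩
      map_add' := fun _ _ => rfl
      map_smul' := fun _ _ => rfl
      invFun := fun w i => w ⟨i⟩
      left_inv := fun _ => rfl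
      right_inv := fun _ => rfl }
  have hL : ∀ x, ‖L x‖ = ‖x‖ := fun x => by
    refine le_antisymm ?_ ?_
    · exact lp.norm_le_of_forall_le (norm_nonneg x) fun i => norm_le_pi_norm x i.down
    · exact (pi_norm_le_iff_of_nonneg (norm_nonneg _)).mpr fun i =>
        lp.norm_apply_le_norm ENNReal.top_ne_zero (L x) ⟨i⟩
  exact hC.iso_mem _ _ ⟨e.trans ⟨L, hL⟩⟩ hmem

theorem isReidClosed_reidClass (κ : WithTop Cardinal.{u}) :
    IsReidClosed κ (reidClass k κ) := by
  have key : ∀ (I : Type u) (W : I → BanachObj k),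
      (Cardinal.mk I : WithTop Cardinal.{u}) < κ → (∀ i, W i ∈ reidClass k κ) →
      boundedProd W ∈ reidClass k κ ∧ completedSum W ∈ reidClass k κ := by
    intro I W hI hW
    choose a ha using fun i => Set.mem_iUnion.mp (hW i)
    have hlt : ∀ i, ∃ β, ∃ _ : β < Order.succ (⨆ j, a j), W i ∈ reidStage k κ β := fun i =>
      ⟨a i, Order.lt_succ_of_le (Ordinal.le_iSup a i), ha i⟩
    constructor
    · refine Set.mem_iUnion.mpr ⟨Order.succ (⨆ j, a j), ?_⟩
      rw [reidStage]
      exact Or.inr ⟨I, hI, W, hlt, Or.inl (Iso.refl _)⟩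
    · refine Set.mem_iUnion.mpr ⟨Order.succ (⨆ j, a j), ?_⟩
      rw [reidStage]
      exact Or.inr ⟨I, hI, W, hlt, Or.inr (Iso.refl _)⟩
  refine ⟨?_, ?_, fun I W hI hW => (key I W hI hW).1, fun I W hI hW => (key I W hI hW).2⟩
  · refine Set.mem_iUnion.mpr ⟨0, ?_⟩
    rw [reidStage]
    exact Or.inl ⟨1, ⟨⟨(LinearEquiv.funUnique (Fin 1) k k).symm, fun x => pi_norm_const x⟩⟩⟩
  · intro V W hVW hW
    obtain ⟨α, hα⟩ := Set.mem_iUnion.mp hW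
    refine Set.mem_iUnion.mpr ⟨α, ?_⟩
    rw [reidStage] at hα ⊢
    rcases hα with ⟨d, ⟨e⟩⟩ | ⟨I, hI, U, hU, h⟩
    · obtain ⟨f⟩ := hVW
      exact Or.inl ⟨d, ⟨f.trans e⟩⟩
    · exact Or.inr ⟨I, hI, U, hU, h.imp hVW.trans hVW.trans⟩

/-- For infinite `κ`, the Reid class is the smallest class of Banach spaces that contains `k` and
is closed under isomorphisms and under bounded direct products and completed direct sums with
fewer than `κ` terms. -/
theorem isLeast_reidClass {κ : WithTop Cardinal.{u}}
    (hκ : (Cardinal.aleph0 : Cardinal.{u}) ≤ κ) :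
    IsLeast {C : Set (BanachObj k) | IsReidClosed κ C} (reidClass k κ) := by
  refine ⟨isReidClosed_reidClass κ, fun C hC => Set.iUnion_subset fun α => ?_⟩
  induction α using WellFoundedLT.induction with
  | ind α ih =>
    intro V hV
    rw [reidStage] at hV
    rcases hV with hV | ⟨I, hI, W, hW, h⟩
    · exact finFree_subset_of_isReidClosed hκ hC hV
    · have hWC : ∀ i, W i ∈ C := fun i => by
        obtain ⟨β, hβ, hi⟩ := hW i
        exact ih β hβ hi
      rcases h with h | h
      · exact hC.iso_mem _ _ h (hC.prod_mem I W hI hWC)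
      · exact hC.iso_mem _ _ h (hC.sum_mem I W hI hWC)

end BanachObj

/-! ### Measurability of sets -/

/-- A set is `ω₁`-measurable if it is uncountable and carries a non-principal ultrafilter that is
closed under intersections of fewer than `ℵ₁` of its members. -/
def IsOmegaOneMeasurable (X : Type u) : Prop :=
  Uncountable X ∧ ∃ F : Ultrafilter X,
    CardinalInterFilter (F : Filter X) (Cardinal.aleph 1) ∧ ∀ x : X, F ≠ pure x

/-- No set with fewer than `κ` elements is `ω₁`-measurable. -/
def NonMeasurabilityCondition (κ : WithTop Cardinal.{u}) : Prop :=
  ∀ X : Type u, (Cardinal.mk X : WithTop Cardinal.{u}) < κ → ¬ IsOmegaOneMeasurable X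

open Filter Topology

/-! ### Chase's lemma over a densely valued field -/

/-! Write `V` for the space of bounded continuous functions on `ℚ`. The invariant is
`FactorsVanish`: every composite `V → W → V` is, after shrinking to some open `U'`, nearly constant
on `U'` when applied to functions supported in `U'`. The identity of `V` fails this, since every
nonempty open set contains the support of a clopen indicator that is not constant there. So it
suffices to prove the invariant for all `W` in the Reid class, by induction on the stage.

Finite-rank operators have vanishing oscillation because their images are spanned by finitely many
continuous functions, and finite sums of such operators inherit it. The two infinite constructions
reduce to finite sums through Chase's lemma, `exists_tail_forall_norm_le`, a gliding hump argument.
For a completed direct sum it is applied to `a : V → Σ W`, with the functions supported in shrinking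
clopen sets as tails: on some tail, all but finitely many coordinates of `a` are negligible.

For a bounded direct product it is applied to `b : Π W → V`. Subtracting the value at a point `p`
and restricting to a neighbourhood basis of `p` turns `b w` into a null sequence. The sets of
indices on which `b` is nearly constant close to `p` form an ideal, and Chase's lemma puts into it a
member of every decreasing sequence of sets with empty intersection. If the index set is not
`ω₁`-measurable, such an ideal contains a cofinite set
(`exists_finset_compl_of_not_isOmegaOneMeasurable`), so again only finitely many factors matter. -/

theorem norm_sub_le_max_of_ultrametric {G : Type*} [NormedAddCommGroup G] [IsUltrametricDist G]
    (x y : G) : ‖x - y‖ ≤ max ‖x‖ ‖y‖ := by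
  simpa [sub_eq_add_neg] using IsUltrametricDist.norm_add_le_max x (-y)

theorem exists_norm_mem_Ioo {k : Type*} [NormedField k]
    (hdense : Dense (Set.range fun x : k => ‖x‖₊)) {a b : ℝ} (ha : 0 ≤ a) (hab : a < b) :
    ∃ c : k, a < ‖c‖ ∧ ‖c‖ < b := by
  lift a to ℝ≥0 using ha
  lift b to ℝ≥0 using (a.2.trans hab.le)
  obtain ⟨_, ⟨c, rfl⟩, h1, h2⟩ := hdense.exists_between (NNReal.coe_lt_coe.mp hab)
  exact ⟨c, h1, h2⟩

/-- If a vector violates the bound `‖f x‖ ≤ s * ‖x‖` by more than a fixed factor, it can be rescaled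
to a vector of norm at most `r` with `‖f x‖ > t`, whenever `t < s * r`. -/
theorem exists_smul_norm_le_lt {k E G : Type*} [NormedField k] [NormedAddCommGroup E]
    [NormedSpace k E] [NormedAddCommGroup G] [NormedSpace k G]
    (hdense : Dense (Set.range fun x : k => ‖x‖₊)) (f : E →ₗ[k] G) {r t t' : ℝ} (hr : 0 < r)
    (ht : 0 ≤ t) (htt' : t < t') {x : E} (hx : t' / r * ‖x‖ < ‖f x‖) :
    ∃ c : k, ‖c • x‖ ≤ r ∧ t < ‖f (c • x)‖ := by
  have hx0 : 0 < ‖x‖ := by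
    rw [norm_pos_iff]
    rintro rfl
    simp at hx
  have ht' : 0 < t' := ht.trans_lt htt'
  -- The upper end of this window keeps `‖c • x‖` at most `r`; the lower end makes `‖f (c • x)‖`
  -- exceed `t`.
  obtain ⟨c, h1, h2⟩ := exists_norm_mem_Ioo hdense (a := t / t' * (r / ‖x‖)) (b := r / ‖x‖)
    (by positivity) (by
      have : t / t' < 1 := (div_lt_one ht').mpr htt'
      have h3 : 0 < r / ‖x‖ := by positivity
      nlinarith)
  refine ⟨c, ?_, ?_⟩
  · rw [norm_smul]
    exact ((lt_div_iff₀ hx0).mp h2).le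
  · have hc : 0 < ‖c‖ := lt_of_le_of_lt (by positivity) h1
    rw [map_smul, norm_smul]
    calc t = t / t' * (r / ‖x‖) * (t' / r * ‖x‖) := by field_simp
      _ ≤ ‖c‖ * (t' / r * ‖x‖) := by gcongr
      _ < ‖c‖ * ‖f x‖ := by gcongr

/-- **Chase's lemma**. A bounded linear map from a space with a topology of tails, in which bounded
sequences converging to zero in the tails are summable, to a family that tends to zero, is
arbitrarily small on some tail outside finitely many coordinates. -/
theorem exists_tail_forall_norm_le {k E J : Type*} {G : J → Type*} [NormedField k]
    [NormedAddCommGroup E] [NormedSpace k E] [∀ j, NormedAddCommGroup (G j)]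
    [∀ j, NormedSpace k (G j)] [∀ j, IsUltrametricDist (G j)]
    (hdense : Dense (Set.range fun x : k => ‖x‖₊))
    (T : ∀ j, E →ₗ[k] G j) (C : ℝ) (hC : ∀ j x, ‖T j x‖ ≤ C * ‖x‖)
    (hT : ∀ x (ε : ℝ), 0 < ε → {j | ε ≤ ‖T j x‖}.Finite)
    (tail : ℕ → Submodule k E) (htail : Antitone tail)
    (hsum : ∀ M : ℕ → ℕ, StrictMono M → ∀ x : ℕ → E, (∀ n, x n ∈ tail (M n)) →
      ∀ r : ℕ → ℝ, Antitone r → (∀ n, ‖x n‖ ≤ r n) →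
        ∃ s, ∀ n, s - ∑ m ∈ Finset.range n, x m ∈ tail (M n) ∧
          ‖s - ∑ m ∈ Finset.range n, x m‖ ≤ r n)
    {ε : ℝ} (hε : 0 < ε) :
    ∃ N, ∃ F : Finset J, ∀ x ∈ tail N, ∀ j ∉ F, ‖T j x‖ ≤ ε * ‖x‖ := by
  classical
  set P : ℝ → Prop := fun c => ∃ N, ∃ F : Finset J, ∀ x ∈ tail N, ∀ j ∉ F, ‖T j x‖ ≤ c * ‖x‖
    with hP
  have Pmono : ∀ {c d}, c ≤ d → P c → P d := fun hcd ⟨N, F, h⟩ =>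
    ⟨N, F, fun x hx j hj => (h x hx j hj).trans (by gcongr)⟩
  have PC : P C := ⟨0, ∅, fun x _ j _ => hC j x⟩
  by_contra hcon
  have hnot : ¬ P ε := hcon
  have hbdd : BddBelow {c | P c} := ⟨ε, fun c hc => by
    by_contra h
    exact hnot (Pmono (not_le.mp h).le hc)⟩
  -- The optimal asymptotic constant: bounds above `s` hold on some tail off a finite set, bounds
  -- below `s` fail on all of them.
  obtain ⟨s, hs⟩ : ∃ s, s = sInf {c | P c} := ⟨_, rfl⟩
  have hεs : ε ≤ s := hs ▸ le_csInf ⟨C, PC⟩ fun c hc => by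
    by_contra h
    exact hnot (Pmono (not_le.mp h).le hc)
  have hs0 : 0 < s := hε.trans_le hεs
  have hbelow : ∀ c < s, ¬ P c := fun c hc h => absurd (hs ▸ csInf_le hbdd h) (not_le.mpr hc)
  have habove : ∀ c, s < c → P c := fun c hc => by
    obtain ⟨d, hd, hdc⟩ := exists_lt_of_csInf_lt ⟨C, PC⟩ (hs ▸ hc)
    exact Pmono hdc.le hd
  have large : ∀ r t : ℝ, 0 < r → 0 ≤ t → t < s * r → ∀ (N : ℕ) (F : Finset J),
      ∃ x ∈ tail N, ∃ j ∉ F, ‖x‖ ≤ r ∧ t < ‖T j x‖ := fun r t hr ht hts N F => by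
    obtain ⟨t', h1, h2⟩ := exists_between hts
    have h3 := hbelow (t' / r) ((div_lt_iff₀ hr).mpr h2)
    simp only [hP, not_exists, not_forall, not_le] at h3
    obtain ⟨x, hx, j, hj, h4⟩ := h3 N F
    obtain ⟨c, h5, h6⟩ := exists_smul_norm_le_lt hdense (T j) hr ht h1 h4
    exact ⟨c • x, (tail N).smul_mem c hx, j, hj, h5, h6⟩
  -- Strict decrease leaves room for `t n` between `s * r (n + 1)` and `s * r n`; staying above `1`
  -- keeps `t n` above `s`. Thus the hump at `n` can exceed `t n` while the remainder, of norm at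
  -- most `r (n + 1)`, cannot.
  set r : ℕ → ℝ := fun n => 1 + (1 / 2) ^ n with hr
  have hr1 : ∀ n, 1 < r n := fun n => lt_add_of_pos_right _ (by positivity)
  have hranti : StrictAnti r := fun a b hab => by
    have := pow_lt_pow_right_of_lt_one₀ (by norm_num : (0 : ℝ) < 1 / 2) (by norm_num) hab
    simp only [hr]
    linarith
  choose t ht1 ht2 using fun n => exists_between
    (mul_lt_mul_of_pos_left (hranti (Nat.lt_succ_self n)) hs0)
  have hst : ∀ n, s < t n := fun n => (lt_mul_of_one_lt_right hs0 (hr1 _)).trans (ht1 n)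
  have small : ∀ n, ∃ N, ∃ F : Finset J, ∀ x ∈ tail N, ‖x‖ ≤ r (n + 1) → ∀ j ∉ F,
      ‖T j x‖ ≤ t n := fun n => by
    have hpos : 0 < r (n + 1) := zero_lt_one.trans (hr1 _)
    obtain ⟨N, F, h⟩ := habove (t n / r (n + 1)) ((lt_div_iff₀ hpos).mpr (ht1 n))
    refine ⟨N, F, fun x hx hxr j hj => (h x hx j hj).trans ?_⟩
    have : 0 ≤ t n := (hs0.trans (hst n)).le
    calc t n / r (n + 1) * ‖x‖ ≤ t n / r (n + 1) * r (n + 1) := by gcongr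
      _ = t n := by field_simp
  choose N F hNF using small
  set M : ℕ → ℕ := fun n => n + ∑ m ∈ Finset.range n, N m with hM
  have hMmono : StrictMono M := strictMono_nat_of_lt_succ fun n => by
    simp only [hM, Finset.sum_range_succ]
    omega
  have hNM : ∀ n, N n ≤ M (n + 1) := fun n => by
    simp only [hM, Finset.sum_range_succ]
    omega
  have step : ∀ (n : ℕ) (A : Finset J), ∃ x ∈ tail (M n), ∃ j ∉ A ∪ F n, ‖x‖ ≤ r n ∧
      t n < ‖T j x‖ := fun n A =>
    large (r n) (t n) (zero_lt_one.trans (hr1 _)) (hs0.trans (hst n)).le (ht2 n) _ _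
  choose X hX jj hjj hXr htX using step
  -- The forbidden coordinates: those already chosen, and those at which an earlier vector has image
  -- of norm at least `s`.
  let A : ℕ → Finset J := fun n => Nat.rec ∅
    (fun n B => B ∪ ({jj n B} ∪ (hT (X n B) s hs0).toFinset)) n
  have hA : ∀ n, A (n + 1) = A n ∪ ({jj n (A n)} ∪ (hT (X n (A n)) s hs0).toFinset) :=
    fun _ => rfl
  have hAmono : Monotone A := monotone_nat_of_le_succ fun n => by
    rw [hA]
    exact Finset.subset_union_left
  have hjA : ∀ n, jj n (A n) ∉ A n := fun n h => hjj n (A n) (Finset.mem_union_left _ h)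
  have hinj : Function.Injective fun n => jj n (A n) := by
    refine Function.Injective.of_lt_imp_ne fun m n hmn h => hjA n ?_
    rw [← h]
    refine hAmono (Nat.succ_le_of_lt hmn) ?_
    rw [Nat.succ_eq_add_one, hA]
    simp
  have hsm : ∀ n, ∀ m < n, ‖T (jj n (A n)) (X m (A m))‖ < s := fun n m hmn => by
    by_contra h
    refine hjA n (hAmono (Nat.succ_le_of_lt hmn) ?_)
    rw [Nat.succ_eq_add_one, hA]
    simp [not_lt.mp h]
  obtain ⟨y, hy⟩ := hsum M hMmono (fun n => X n (A n)) (fun n => hX n _) r hranti.antitone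
    fun n => hXr n _
  -- At the `n`-th chosen coordinate the earlier terms and the remainder contribute at most `t n`,
  -- so they cannot cancel the `n`-th hump. This yields infinitely many large coordinates of `y`.
  have key : ∀ n, s ≤ ‖T (jj n (A n)) y‖ := fun n => by
    by_contra hlt
    have h0 : 0 ≤ t n := (hs0.trans (hst n)).le
    obtain ⟨h1, h2⟩ := hy (n + 1)
    have h3 := hNF n _ (htail (hNM n) h1) h2 (jj n (A n))
      fun h => hjj n (A n) (Finset.mem_union_right _ h)
    have h4 : ‖∑ m ∈ Finset.range n, T (jj n (A n)) (X m (A m))‖ ≤ t n :=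
      IsUltrametricDist.norm_sum_le_of_forall_le_of_nonneg h0 fun m hm =>
        ((hsm n m (Finset.mem_range.mp hm)).trans (hst n)).le
    have h5 : T (jj n (A n)) (X n (A n)) = (T (jj n (A n)) y
        - T (jj n (A n)) (y - ∑ m ∈ Finset.range (n + 1), X m (A m)))
        - ∑ m ∈ Finset.range n, T (jj n (A n)) (X m (A m)) := by
      rw [← map_sub, sub_sub_cancel, Finset.sum_range_succ, map_add, map_sum]
      abel
    have h6 := htX n (A n)
    rw [h5] at h6
    refine absurd h6 (not_lt.mpr ?_)
    refine (norm_sub_le_max_of_ultrametric _ _).trans (max_le ((norm_sub_le_max_of_ultrametric _ _).trans (max_le ?_ h3)) h4)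
    exact ((not_le.mp hlt).trans (hst n)).le
  exact Set.infinite_of_injective_forall_mem hinj key (hT y s hs0)

/-! ### Summation of families with shrinking supports -/

/-- At each point only finitely many terms are nonzero, so the sum is formed pointwise and the norms
need not tend to zero. The ultrametric inequality and the monotonicity of `r` control the
remainders. -/
theorem exists_forall_norm_sub_sum_le {Y : Type*} {G : Y → Type*} [∀ y, NormedAddCommGroup (G y)]
    [∀ y, IsUltrametricDist (G y)] (B : ℕ → Set Y) (hB : Antitone B) (hB0 : ∀ y, ∃ n, y ∉ B n)
    (x : ℕ → ∀ y, G y) (hx : ∀ n, ∀ y ∉ B n, x n y = 0) (r : ℕ → ℝ) (hr : Antitone r)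
    (hxr : ∀ n y, ‖x n y‖ ≤ r n) :
    ∃ s : ∀ y, G y, ∀ n y, (y ∉ B n → s y - ∑ m ∈ Finset.range n, x m y = 0) ∧
      ‖s y - ∑ m ∈ Finset.range n, x m y‖ ≤ r n := by
  choose K hK using hB0
  refine ⟨fun y => ∑ m ∈ Finset.range (K y), x m y, fun n y => ?_⟩
  have hzero : ∀ n, y ∉ B n → ∀ m, n ≤ m → x m y = 0 := fun n hn m hnm =>
    hx m y fun h => hn (hB hnm h)
  have hr0 : 0 ≤ r n := (norm_nonneg _).trans (hxr n y)
  rcases le_total (K y) n with h | h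
  · have h1 : ∑ m ∈ Finset.range (K y), x m y - ∑ m ∈ Finset.range n, x m y = 0 := by
      rw [← Finset.sum_range_add_sum_Ico _ h, sub_add_cancel_left, neg_eq_zero]
      exact Finset.sum_eq_zero fun m hm => hzero _ (hK y) m (Finset.mem_Ico.mp hm).1
    exact ⟨fun _ => h1, by rw [h1, norm_zero]; exact hr0⟩
  · beta_reduce
    rw [← Finset.sum_range_add_sum_Ico _ h, add_sub_cancel_left]
    refine ⟨fun hn => Finset.sum_eq_zero fun m hm => hzero _ hn m (Finset.mem_Ico.mp hm).1, ?_⟩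
    exact IsUltrametricDist.norm_sum_le_of_forall_le_of_nonneg hr0 fun m hm =>
      (hxr m y).trans (hr (Finset.mem_Ico.mp hm).1)

/-! ### Ideals on sets that are not measurable -/

/-- If `A` cannot be split into two sets outside a σ-ideal containing the finite sets, the set
carries a non-principal ultrafilter closed under countable intersections. -/
theorem isOmegaOneMeasurable_of_atom {I : Type u} (Q : Set I → Prop)
    (hmono : ∀ A B, A ⊆ B → Q B → Q A) (hfin : ∀ F : Set I, F.Finite → Q F)
    (hunion : ∀ A B, Q A → Q B → Q (A ∪ B))
    (hseq : ∀ B : ℕ → Set I, Antitone B → (∀ i, ∃ n, i ∉ B n) → ∃ n, Q (B n))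
    (A : Set I) (hA : ¬ Q A) (hatom : ∀ S, Q (A ∩ S) ∨ Q (A \ S)) : IsOmegaOneMeasurable I := by
  let f : Filter I :=
    { sets := {S | Q (A \ S)}
      univ_sets := by simpa using hfin ∅ Set.finite_empty
      sets_of_superset := fun {S T} hS hST => hmono _ _ (Set.sdiff_subset_sdiff_right hST) hS
      inter_sets := fun {S T} hS hT => by
        have := hunion _ _ hS hT
        rwa [← Set.sdiff_inter] at this }
  have hf : ∀ S, S ∈ f ↔ Q (A \ S) := fun _ => Iff.rfl
  let U : Ultrafilter I := Ultrafilter.ofComplNotMemIff f fun S => by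
    rw [hf, hf, Set.sdiff_compl]
    refine ⟨(hatom S).resolve_left, fun h1 h2 => hA ?_⟩
    have := hunion _ _ h2 h1
    rwa [Set.inter_union_sdiff] at this
  have hU : ∀ S, S ∈ U ↔ Q (A \ S) := fun _ => Iff.rfl
  have hcount : CountableInterFilter (U : Filter I) := by
    refine ⟨fun 𝒮 h𝒮 hmem => ?_⟩
    rcases 𝒮.eq_empty_or_nonempty with rfl | hne
    · simp
    obtain ⟨S, rfl⟩ := h𝒮.exists_eq_range hne
    set R : ℕ → Set I := fun n => ⋂ m ∈ Finset.range n, S m with hR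
    have hRanti : Antitone R := fun m n hmn => Set.biInter_subset_biInter_left fun a ha =>
      Finset.range_mono hmn ha
    -- These differences decrease to the empty set, so some finite intersection exceeds the
    -- countable one only by a small set.
    obtain ⟨n, hn⟩ := hseq (fun n => R n \ ⋂₀ Set.range S)
      (fun m n hmn => Set.sdiff_subset_sdiff_left (hRanti hmn)) fun i => by
        by_cases hi : i ∈ ⋂₀ Set.range S
        · exact ⟨0, fun h => h.2 hi⟩
        · simp only [Set.sInter_range, Set.mem_iInter, not_forall] at hi
          obtain ⟨m, hm⟩ := hi
          refine ⟨m + 1, fun h => hm ?_⟩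
          have := h.1
          simp only [hR, Set.mem_iInter, Finset.mem_range] at this
          exact this m m.lt_succ_self
    have hRn : R n ∈ (U : Filter I) := by
      simp only [hR]
      exact (Filter.biInter_finset_mem _).mpr fun m _ => hmem _ ⟨m, rfl⟩
    refine (hU _).mpr (hmono _ _ ?_ (hunion _ _ ((hU _).mp hRn) hn))
    intro i hi
    by_cases h : i ∈ R n
    · exact Or.inr ⟨h, hi.2⟩
    · exact Or.inl ⟨hi.1, h⟩
  have hnonp : ∀ x, ({x} : Set I) ∉ U := fun x h => by
    refine hA (hmono _ _ ?_ (hunion _ _ ((hU _).mp h) (hfin {x} (Set.finite_singleton x))))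
    intro i hi
    by_cases h : i ∈ ({x} : Set I)
    · exact Or.inr h
    · exact Or.inl ⟨hi, h⟩
  refine ⟨?_, U, cardinalInterFilter_aleph_one_iff.mpr hcount, fun x hx => hnonp x ?_⟩
  -- On a countable set, intersecting the complements of all points would put the empty set into
  -- `U`.
  · by_contra hc
    rw [not_uncountable_iff] at hc
    have : (⋂ x : I, ({x} : Set I)ᶜ) ∈ (U : Filter I) :=
      countable_iInter_mem.mpr fun x => Ultrafilter.compl_mem_iff_notMem.mpr (hnonp x)
    have h0 : (⋂ x : I, ({x} : Set I)ᶜ) = ∅ := by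
      ext i
      simp
    rw [h0] at this
    exact U.neBot.ne (Filter.empty_mem_iff_bot.mp this)
  · rw [hx]
    exact Set.mem_singleton x

/-- On a set that is not `ω₁`-measurable, an ideal that contains some member of every decreasing
sequence with empty intersection contains a cofinite set. -/
theorem exists_finset_compl_of_not_isOmegaOneMeasurable {I : Type u}
    (hI : ¬ IsOmegaOneMeasurable I) (Q : Set I → Prop)
    (hmono : ∀ A B, A ⊆ B → Q B → Q A) (hunion : ∀ A B, Q A → Q B → Q (A ∪ B))
    (hseq : ∀ B : ℕ → Set I, Antitone B → (∀ i, ∃ n, i ∉ B n) → ∃ n, Q (B n)) :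
    ∃ F : Finset I, Q {i | i ∉ F} := by
  classical
  -- Passing to `Q` modulo finite sets makes all finite sets small, as the ultrafilter construction
  -- requires.
  set R : Set I → Prop := fun A => ∃ F : Finset I, Q (A \ F) with hR
  have hQR : ∀ A, Q A → R A := fun A h => ⟨∅, by simpa using h⟩
  have Rmono : ∀ A B, A ⊆ B → R B → R A := fun A B h ⟨F, hF⟩ =>
    ⟨F, hmono _ _ (Set.sdiff_subset_sdiff_left h) hF⟩
  have Runion : ∀ A B, R A → R B → R (A ∪ B) := fun A B ⟨F, hF⟩ ⟨F', hF'⟩ => by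
    refine ⟨F ∪ F', hmono _ _ ?_ (hunion _ _ hF hF')⟩
    rintro i ⟨h1 | h1, h2⟩
    · exact Or.inl ⟨h1, fun h => h2 (by simp [Finset.mem_coe.mp h])⟩
    · exact Or.inr ⟨h1, fun h => h2 (by simp [Finset.mem_coe.mp h])⟩
  have Q0 : Q ∅ := by
    obtain ⟨n, hn⟩ := hseq (fun _ => ∅) antitone_const (fun i => ⟨0, id⟩)
    exact hn
  have Rfin : ∀ F : Set I, F.Finite → R F := fun F hF => ⟨hF.toFinset, by simpa using Q0⟩
  by_contra hcon
  have huniv : ¬ R Set.univ := fun ⟨F, hF⟩ => hcon ⟨F, hmono _ (Set.univ \ F) (fun i hi => ⟨trivial, hi⟩) hF⟩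
  have hsplit : ∀ A, ¬ R A → ∃ S, ¬ R (A ∩ S) ∧ ¬ R (A \ S) := fun A hA => by
    by_contra h
    push Not at h
    exact hI (isOmegaOneMeasurable_of_atom R Rmono Rfin Runion
      (fun B h1 h2 => (hseq B h1 h2).imp fun n hn => hQR _ hn) A hA fun S =>
        or_iff_not_imp_left.mpr (h S))
  choose S hS1 hS2 using hsplit
  -- Without atoms, large pieces can be split off forever. The piece removed at stage `n` lies in `D
  -- n \ ⋂ m, D m`, and these sets decrease to the empty set, so one of the removed pieces would be
  -- small.
  let D : ℕ → {A // ¬ R A} := fun n => Nat.rec ⟨Set.univ, huniv⟩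
    (fun _ A => ⟨A.1 ∩ S A.1 A.2, hS1 A.1 A.2⟩) n
  have hD : ∀ n, (D (n + 1)).1 = (D n).1 ∩ S (D n).1 (D n).2 := fun _ => rfl
  have hDanti : Antitone fun n => (D n).1 := antitone_nat_of_succ_le fun n => by
    rw [hD]
    exact Set.inter_subset_left
  obtain ⟨n, hn⟩ := hseq (fun n => (D n).1 \ ⋂ m, (D m).1)
    (fun m n hmn => Set.sdiff_subset_sdiff_left (hDanti hmn)) fun i => by
      by_cases hi : i ∈ ⋂ m, (D m).1
      · exact ⟨0, fun h => h.2 hi⟩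
      · rw [Set.mem_iInter, not_forall] at hi
        exact hi.imp fun m hm h => hm h.1
  refine hS2 _ (D n).2 (Rmono _ _ ?_ (hQR _ hn))
  refine fun i hi => ⟨hi.1, fun h => hi.2 ?_⟩
  have := Set.mem_iInter.mp h (n + 1)
  rw [hD] at this
  exact this.2

namespace BanachObj

variable {k : Type u} [NormedField k]

/-! ### Supports in bounded direct products and in spaces of continuous functions -/

/-- The elements of the bounded direct product that vanish outside `A`. -/
def lpSupported {I : Type u} (W : I → BanachObj k) (A : Set I) :
    Submodule k (lp (fun i => (W i : Type u)) ∞) where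
  carrier := {w | ∀ i ∉ A, w i = 0}
  zero_mem' := fun _ _ => rfl
  add_mem' := fun {v w} hv hw i hi => by
    rw [lp.coeFn_add, Pi.add_apply, hv i hi, hw i hi, add_zero]
  smul_mem' := fun c w hw i hi => by
    rw [lp.coeFn_smul, Pi.smul_apply, hw i hi, smul_zero]

theorem exists_sum_lpSupported {I : Type u} (W : I → BanachObj k) (B : ℕ → Set I)
    (hB : Antitone B) (hB0 : ∀ i, ∃ n, i ∉ B n) (x : ℕ → lp (fun i => (W i : Type u)) ∞)
    (hx : ∀ n, x n ∈ lpSupported W (B n)) (r : ℕ → ℝ) (hr : Antitone r)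
    (hxr : ∀ n, ‖x n‖ ≤ r n) :
    ∃ s, ∀ n, s - ∑ m ∈ Finset.range n, x m ∈ lpSupported W (B n) ∧
      ‖s - ∑ m ∈ Finset.range n, x m‖ ≤ r n := by
  obtain ⟨s, hs⟩ := exists_forall_norm_sub_sum_le B hB hB0 (fun n i => x n i) hx r hr fun n i =>
    (lp.norm_apply_le_norm ENNReal.top_ne_zero (x n) i).trans (hxr n)
  have hmem : Memℓp s ∞ := memℓp_infty ⟨r 0, by
    rintro _ ⟨i, rfl⟩
    simpa using (hs 0 i).2⟩
  have hco : ∀ n i, ((⟨s, hmem⟩ : lp (fun i => (W i : Type u)) ∞) -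
      ∑ m ∈ Finset.range n, x m : lp (fun i => (W i : Type u)) ∞) i
        = s i - ∑ m ∈ Finset.range n, x m i := fun n i => by
    rw [lp.coeFn_sub, Pi.sub_apply, lp.coeFn_sum, Finset.sum_apply]
  refine ⟨⟨s, hmem⟩, fun n => ⟨fun i hi => ?_, ?_⟩⟩
  · rw [hco]
    exact (hs n i).1 hi
  · refine lp.norm_le_of_forall_le ((norm_nonneg _).trans (hxr n)) fun i => ?_
    rw [hco]
    exact (hs n i).2

theorem exists_add_eq_of_lpSupported_union {I : Type u} (W : I → BanachObj k) (A B : Set I)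
    (w : lp (fun i => (W i : Type u)) ∞) (hw : w ∈ lpSupported W (A ∪ B)) :
    ∃ v ∈ lpSupported W A, ∃ v' ∈ lpSupported W B, v + v' = w ∧ ‖v‖ ≤ ‖w‖ ∧ ‖v'‖ ≤ ‖w‖ := by
  classical
  have hb : ∀ (S : Set I) i, ‖if i ∈ S then w i else 0‖ ≤ ‖w‖ := fun S i => by
    split_ifs
    · exact lp.norm_apply_le_norm ENNReal.top_ne_zero w i
    · rw [norm_zero]
      exact norm_nonneg w
  have hmem : ∀ S : Set I, Memℓp (fun i => if i ∈ S then w i else 0) ∞ := fun S =>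
    memℓp_infty ⟨‖w‖, by
      rintro _ ⟨i, rfl⟩
      exact hb S i⟩
  -- Cutting the second piece to `Aᶜ` instead of `B` avoids counting the overlap twice.
  refine ⟨⟨_, hmem A⟩, fun i hi => if_neg hi, ⟨_, hmem Aᶜ⟩, fun i hi => ?_, ?_,
    lp.norm_le_of_forall_le (norm_nonneg w) (hb A),
    lp.norm_le_of_forall_le (norm_nonneg w) (hb Aᶜ)⟩
  · by_cases h : i ∈ A
    · exact if_neg (not_not.mpr h)
    · exact (if_pos h).trans (hw i fun h' => h'.elim h hi)
  · refine lp.ext (funext fun i => ?_)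
    rw [lp.coeFn_add, Pi.add_apply]
    by_cases h : i ∈ A <;> simp [h]

theorem sub_sum_single_apply {I : Type u} [DecidableEq I] (W : I → BanachObj k)
    (w : lp (fun i => (W i : Type u)) ∞) (F : Finset I) (i : I) :
    (w - ∑ j ∈ F, lp.single ∞ j (w j) : lp (fun i => (W i : Type u)) ∞) i
      = if i ∈ F then 0 else w i := by
  rw [lp.coeFn_sub, Pi.sub_apply, lp.coeFn_sum, Finset.sum_apply]
  simp only [lp.single_apply, Finset.sum_pi_single]
  split_ifs <;> simp

theorem norm_sub_sum_single_le {I : Type u} [DecidableEq I] (W : I → BanachObj k)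
    (w : lp (fun i => (W i : Type u)) ∞) (F : Finset I) {c : ℝ} (hc : 0 ≤ c)
    (h : ∀ i ∉ F, ‖w i‖ ≤ c) :
    ‖w - ∑ j ∈ F, lp.single ∞ j (w j)‖ ≤ c := by
  refine lp.norm_le_of_forall_le hc fun i => ?_
  rw [sub_sum_single_apply]
  split_ifs with hi
  · rwa [norm_zero]
  · exact h i hi

/-- The bounded continuous functions that vanish outside `A`. -/
def bcfSupported (k : Type u) [NormedField k] {X : Type} [TopologicalSpace X] (A : Set X) :
    Submodule k (X →ᵇ k) where
  carrier := {f | ∀ x ∉ A, f x = 0}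
  zero_mem' := fun _ _ => rfl
  add_mem' := fun {f g} hf hg x hx => by
    rw [BoundedContinuousFunction.add_apply, hf x hx, hg x hx, add_zero]
  smul_mem' := fun c f hf x hx => by
    rw [BoundedContinuousFunction.smul_apply, hf x hx, smul_zero]

/-- Closedness of the `B n` makes the pointwise sum continuous: near a point off `B n` it agrees
with a finite partial sum. -/
theorem exists_sum_bcfSupported [IsUltrametricDist k] {X : Type} [TopologicalSpace X]
    (B : ℕ → Set X) (hB : Antitone B) (hBc : ∀ n, IsClosed (B n)) (hB0 : ∀ i, ∃ n, i ∉ B n)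
    (x : ℕ → (X →ᵇ k)) (hx : ∀ n, x n ∈ bcfSupported k (B n)) (r : ℕ → ℝ) (hr : Antitone r)
    (hxr : ∀ n, ‖x n‖ ≤ r n) :
    ∃ s, ∀ n, s - ∑ m ∈ Finset.range n, x m ∈ bcfSupported k (B n) ∧
      ‖s - ∑ m ∈ Finset.range n, x m‖ ≤ r n := by
  obtain ⟨s, hs⟩ := exists_forall_norm_sub_sum_le B hB hB0 (fun n i => x n i) hx r hr fun n i =>
    ((x n).norm_coe_le_norm i).trans (hxr n)
  have hcont : Continuous s := by
    refine continuous_iff_continuousAt.mpr fun y => ?_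
    obtain ⟨n, hn⟩ := hB0 y
    have h1 : ContinuousAt (fun y => ∑ m ∈ Finset.range n, x m y) y := by fun_prop
    refine h1.congr ?_
    filter_upwards [(hBc n).isOpen_compl.mem_nhds hn] with z hz
    exact (sub_eq_zero.mp ((hs n z).1 hz)).symm
  refine ⟨BoundedContinuousFunction.ofNormedAddCommGroup s hcont (r 0)
    fun y => by simpa using (hs 0 y).2, fun n => ⟨fun y hy => ?_, ?_⟩⟩
  · simpa using (hs n y).1 hy
  · refine (BoundedContinuousFunction.norm_le ((norm_nonneg _).trans (hxr n))).mpr fun y => ?_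
    simpa using (hs n y).2

/-! ### Operators with vanishing oscillation -/

/-- Density supplies a scalar of norm greater than `1`, so `k` is nontrivially normed and continuity
gives a bound. -/
theorem exists_pos_bound_of_dense (hdense : Dense (Set.range fun x : k => ‖x‖₊)) {E G : Type*}
    [NormedAddCommGroup E] [NormedSpace k E] [NormedAddCommGroup G] [NormedSpace k G]
    (f : E →L[k] G) : ∃ C : ℝ, 0 < C ∧ ∀ x, ‖f x‖ ≤ C * ‖x‖ := by
  let _ : NontriviallyNormedField k :=
    { ‹NormedField k› with
      non_trivial := by
        obtain ⟨c, h, -⟩ := exists_norm_mem_Ioo hdense zero_le_one (one_lt_two (α := ℝ))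
        exact ⟨c, h⟩ }
  exact f.bound

/-- Every nonempty open set contains a nonempty open subset `U` such that the restriction of `S`
to the functions supported in `U`, followed by restriction to `U`, is nearly constant. -/
def OscillationVanishes {X : Type} [TopologicalSpace X] (S : (X →ᵇ k) → (X →ᵇ k)) : Prop :=
  ∀ ε : ℝ, 0 < ε → ∀ U : Set X, IsOpen U → U.Nonempty → ∃ U' ⊆ U, IsOpen U' ∧ U'.Nonempty ∧
    ∀ f ∈ bcfSupported k U', ∀ x ∈ U', ∀ y ∈ U', ‖S f x - S f y‖ ≤ ε * ‖f‖

/-- The open set is shrunk once per summand; functions supported in the smaller set remain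
admissible for the earlier ones, and the ultrametric inequality preserves `ε`. -/
theorem OscillationVanishes.sum [IsUltrametricDist k] {X : Type} [TopologicalSpace X] {ι : Type*}
    (S : ι → (X →ᵇ k) → (X →ᵇ k)) (hS : ∀ i, OscillationVanishes (S i)) (F : Finset ι) :
    OscillationVanishes fun f => ∑ i ∈ F, S i f := by
  classical
  intro ε hε U hU hne
  induction F using Finset.induction_on with
  | empty =>
    refine ⟨U, subset_rfl, hU, hne, fun f _ x _ y _ => ?_⟩
    simp only [Finset.sum_empty, BoundedContinuousFunction.coe_zero, Pi.zero_apply, sub_self,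
      norm_zero]
    positivity
  | insert i F hi ih =>
    obtain ⟨U', h1, h2, h3, h4⟩ := ih
    obtain ⟨U'', h5, h6, h7, h8⟩ := hS i ε hε U' h2 h3
    refine ⟨U'', h5.trans h1, h6, h7, fun f hf x hx y hy => ?_⟩
    have hf' : f ∈ bcfSupported k U' := fun z hz => hf z fun h => hz (h5 h)
    beta_reduce
    rw [Finset.sum_insert hi, BoundedContinuousFunction.add_apply,
      BoundedContinuousFunction.add_apply, add_sub_add_comm]
    exact (IsUltrametricDist.norm_add_le_max _ _).trans
      (max_le (h8 f hf x hx y hy) (h4 f hf' x (h5 hx) y (h5 hy)))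

/-- All endomorphisms of the space of bounded continuous functions on `X` that factor through `W`
have vanishing oscillation. -/
def FactorsVanish (X : Type) [TopologicalSpace X] (W : BanachObj k) : Prop :=
  ∀ (a : (X →ᵇ k) →L[k] W) (b : W →L[k] (X →ᵇ k)), OscillationVanishes fun f => b (a f)

theorem FactorsVanish.of_iso {X : Type} [TopologicalSpace X] {V W : BanachObj k} (h : V.Iso W)
    (hW : FactorsVanish X W) : FactorsVanish X V := by
  obtain ⟨e⟩ := h
  intro a b
  have := hW ((e : V ≃L[k] W).toContinuousLinearMap.comp a)
    (b.comp (e.symm : W ≃L[k] V).toContinuousLinearMap)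
  simpa using this

/-- The composite is a sum of rank-one operators `f ↦ φ f • g`, and the continuous function `g` is
nearly constant near any point. -/
theorem factorsVanish_of_mem_finFree [IsUltrametricDist k] {X : Type} [TopologicalSpace X]
    (hdense : Dense (Set.range fun x : k => ‖x‖₊)) {V : BanachObj k} (hV : V ∈ finFree k) : FactorsVanish X V := by
  classical
  obtain ⟨d, ⟨e⟩⟩ := hV
  intro a b
  have hsum : (fun f => b (a f)) =
      fun f => ∑ i : Fin d, e (a f) i • b (e.symm (Pi.single i 1)) := by
    funext f
    conv_lhs => rw [← e.symm_apply_apply (a f), pi_eq_sum_univ' (e (a f))]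
    simp only [map_sum, map_smul]
  rw [hsum]
  refine OscillationVanishes.sum _ (fun i => ?_) _
  intro ε hε U hU ⟨p, hp⟩
  obtain ⟨C, hC0, hC⟩ := exists_pos_bound_of_dense hdense a
  set g := b (e.symm (Pi.single i 1))
  have hpos : 0 < ε / C := by positivity
  refine ⟨U ∩ {x | ‖g x - g p‖ < ε / C}, Set.inter_subset_left,
    hU.inter (isOpen_lt (by fun_prop) continuous_const), ⟨p, hp, by simpa using hpos⟩,
    fun f _ x hx y hy => ?_⟩
  have h1 : ‖e (a f) i‖ ≤ C * ‖f‖ :=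
    (norm_le_pi_norm _ i).trans ((e.norm_map _).le.trans (hC f))
  have h2 : ‖g x - g y‖ ≤ ε / C := by
    rw [← sub_sub_sub_cancel_right _ _ (g p)]
    exact (norm_sub_le_max_of_ultrametric _ _).trans (max_le hx.2.le hy.2.le)
  rw [BoundedContinuousFunction.smul_apply, BoundedContinuousFunction.smul_apply, ← smul_sub,
    norm_smul]
  calc ‖e (a f) i‖ * ‖g x - g y‖ ≤ (C * ‖f‖) * (ε / C) := by gcongr
    _ = ε * ‖f‖ := by field_simp

/-! ### Completed direct sums -/

/-- The inclusion of a summand into the completed direct sum. -/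
noncomputable def singleNull {I : Type u} [DecidableEq I] (W : I → BanachObj k) (i : I) :
    W i →L[k] nullSubmodule W :=
  (lp.singleContinuousLinearMap k (fun i => (W i : Type u)) ∞ i).codRestrict (nullSubmodule W)
    fun w ε hε => by
      refine (Set.finite_singleton i).subset fun j hj => ?_
      by_contra h
      have h1 : ε ≤ ‖lp.single (E := fun i => (W i : Type u)) ∞ i w j‖ := hj
      rw [lp.single_apply_ne _ _ _ h, norm_zero] at h1
      exact absurd hε (not_lt.mpr h1)

/-- Chase's lemma for `a` leaves finitely many summands plus an error of norm at most `ε * ‖f‖` for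
`f` supported in some `A N`. -/
theorem oscillationVanishes_nullSubmodule [IsUltrametricDist k] {X : Type} [TopologicalSpace X]
    (hdense : Dense (Set.range fun x : k => ‖x‖₊))
    (hX : ∀ U : Set X, IsOpen U → U.Nonempty → ∃ A : ℕ → Set X, Antitone A ∧
      (∀ n, IsClopen (A n)) ∧ (∀ n, (A n).Nonempty) ∧ (∀ n, A n ⊆ U) ∧ ∀ x, ∃ n, x ∉ A n)
    {I : Type u} (W : I → BanachObj k) (hW : ∀ i, FactorsVanish X (W i))
    (a : (X →ᵇ k) →L[k] nullSubmodule W) (b : nullSubmodule W →L[k] (X →ᵇ k)) :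
    OscillationVanishes fun f => b (a f) := by
  classical
  intro ε hε U hU hne
  obtain ⟨A, hA, hAc, hAne, hAU, hA0⟩ := hX U hU hne
  obtain ⟨C, hC0, hC⟩ := exists_pos_bound_of_dense hdense a
  obtain ⟨D, hD0, hD⟩ := exists_pos_bound_of_dense hdense b
  let T : ∀ i, (X →ᵇ k) →ₗ[k] W i := fun i =>
    (lp.evalCLM k (fun i => (W i : Type u)) ∞ i).toLinearMap ∘ₗ
      (nullSubmodule W).subtype ∘ₗ a.toLinearMap
  have hpos : 0 < ε / D := by positivity
  obtain ⟨N, F, hNF⟩ := exists_tail_forall_norm_le hdense T C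
    (fun i f => (lp.norm_apply_le_norm ENNReal.top_ne_zero _ i).trans (hC f))
    (fun f ε hε => (a f).2 ε hε) (fun n => bcfSupported k (A n))
    (fun m n hmn f hf x hx => hf x fun h => hx (hA hmn h))
    (fun M hM x hx r hr hxr => exists_sum_bcfSupported (fun n => A (M n))
      (hA.comp_monotone hM.monotone) (fun n => (hAc _).isClosed)
      (fun x => (hA0 x).imp fun n hn h => hn (hA hM.le_apply h)) x hx r hr hxr) hpos
  obtain ⟨U', h1, h2, h3, h4⟩ := OscillationVanishes.sum
    (fun i f => b (singleNull W i (T i f)))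
    (fun i => hW i ((lp.evalCLM k (fun i => (W i : Type u)) ∞ i).comp
      ((nullSubmodule W).subtypeL.comp a)) (b.comp (singleNull W i))) F ε hε (A N) (hAc N).isOpen
      (hAne N)
  refine ⟨U', h1.trans (hAU N), h2, h3, fun f hf x hx y hy => ?_⟩
  have hfN : f ∈ bcfSupported k (A N) := fun z hz => hf z fun h => hz (h1 h)
  -- Removing the exceptional coordinates leaves only those that Chase's lemma bounds by `ε / D`,
  -- where `D` bounds `b`.
  set w := a f - ∑ i ∈ F, singleNull W i (T i f) with hw
  have hwn : ‖w‖ ≤ ε / D * ‖f‖ := by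
    have h5 : (w : lp (fun i => (W i : Type u)) ∞) = (a f : lp (fun i => (W i : Type u)) ∞) -
        ∑ i ∈ F, lp.single ∞ i ((a f : lp (fun i => (W i : Type u)) ∞) i) := by
      rw [hw, Submodule.coe_sub, Submodule.coe_sum]
      rfl
    change ‖(w : lp (fun i => (W i : Type u)) ∞)‖ ≤ _
    rw [h5]
    exact norm_sub_sum_single_le W _ F (by positivity) (hNF f hfN)
  have hbw : ‖b w‖ ≤ ε * ‖f‖ := by
    refine (hD w).trans ?_
    calc D * ‖w‖ ≤ D * (ε / D * ‖f‖) := by gcongr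
      _ = ε * ‖f‖ := by field_simp
  have hsplit : b (a f) = b w + ∑ i ∈ F, b (singleNull W i (T i f)) := by
    rw [hw, map_sub, map_sum, sub_add_cancel]
  beta_reduce
  rw [hsplit, BoundedContinuousFunction.add_apply, BoundedContinuousFunction.add_apply,
    add_sub_add_comm]
  refine (IsUltrametricDist.norm_add_le_max _ _).trans (max_le ?_ (h4 f hf x hx y hy))
  exact (norm_sub_le_max_of_ultrametric _ _).trans
    (max_le (((b w).norm_coe_le_norm x).trans hbw) (((b w).norm_coe_le_norm y).trans hbw))

/-! ### Bounded direct products -/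

/-- The linear map `f ↦ f - f p`, followed by restriction to `B`. -/
def subConstRestrict {X : Type} [TopologicalSpace X] (p : X) (B : Set X) :
    (X →ᵇ k) →ₗ[k] (B →ᵇ k) where
  toFun f := (f - BoundedContinuousFunction.const X (f p)).domRestrict B
  map_add' f g := by
    ext x
    exact add_sub_add_comm _ _ _ _
  map_smul' c f := by
    ext x
    exact (mul_sub _ _ _).symm

theorem subConstRestrict_apply {X : Type} [TopologicalSpace X] (p : X) (B : Set X) (f : X →ᵇ k)
    (x : B) : subConstRestrict p B f x = f x - f p := rfl

theorem norm_subConstRestrict_le [IsUltrametricDist k] {X : Type} [TopologicalSpace X] (p : X)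
    (B : Set X) (f : X →ᵇ k) : ‖subConstRestrict p B f‖ ≤ ‖f‖ := by
  refine (BoundedContinuousFunction.norm_le (norm_nonneg f)).mpr fun x => ?_
  rw [subConstRestrict_apply]
  exact (norm_sub_le_max_of_ultrametric _ _).trans
    (max_le (f.norm_coe_le_norm _) (f.norm_coe_le_norm _))

theorem finite_le_norm_subConstRestrict {X : Type} [TopologicalSpace X] (p : X) (B : ℕ → Set X)
    (hB : (𝓝 p).HasAntitoneBasis B) (f : X →ᵇ k) {ε : ℝ} (hε : 0 < ε) :
    {j | ε ≤ ‖subConstRestrict p (B j) f‖}.Finite := by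
  have h1 : {x | ‖f x - f p‖ < ε / 2} ∈ 𝓝 p :=
    (isOpen_lt (by fun_prop) continuous_const).mem_nhds (by simpa using half_pos hε)
  obtain ⟨n, hn⟩ := hB.mem_iff.mp h1
  refine (Set.finite_lt_nat n).subset fun j hj => ?_
  by_contra hnj
  refine absurd (le_trans hj ?_) (not_le.mpr (half_lt_self hε))
  refine (BoundedContinuousFunction.norm_le (half_pos hε).le).mpr fun x => ?_
  exact (hn (hB.antitone (not_lt.mp hnj) x.2)).le

/-- Here the error need not be small: after removing finitely many factors, `b w` is only close to
its value at `p` on a neighbourhood of `p`, which suffices because oscillation ignores constants. -/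
theorem oscillationVanishes_lp [IsUltrametricDist k] {X : Type} [TopologicalSpace X]
    [FirstCountableTopology X] (hdense : Dense (Set.range fun x : k => ‖x‖₊))
    {I : Type u} (hI : ¬ IsOmegaOneMeasurable I)
    (W : I → BanachObj k) (hW : ∀ i, FactorsVanish X (W i))
    (a : (X →ᵇ k) →L[k] lp (fun i => (W i : Type u)) ∞)
    (b : lp (fun i => (W i : Type u)) ∞ →L[k] (X →ᵇ k)) :
    OscillationVanishes fun f => b (a f) := by
  classical
  intro ε hε U hU ⟨p, hp⟩
  obtain ⟨B, hB⟩ := (𝓝 p).exists_antitone_basis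
  obtain ⟨C, hC0, hC⟩ := exists_pos_bound_of_dense hdense a
  obtain ⟨D, hD0, hD⟩ := exists_pos_bound_of_dense hdense b
  have : ∀ j, IsUltrametricDist (B j →ᵇ k) := fun j => bcf_isUltrametricDist (B j)
  let T : ∀ j, lp (fun i => (W i : Type u)) ∞ →ₗ[k] (B j →ᵇ k) := fun j =>
    subConstRestrict p (B j) ∘ₗ b.toLinearMap
  have hpos : 0 < ε / C := by positivity
  obtain ⟨F, G, hFG⟩ := exists_finset_compl_of_not_isOmegaOneMeasurable hI
    (fun A => ∃ G : Finset ℕ, ∀ w ∈ lpSupported W A, ∀ j ∉ G, ‖T j w‖ ≤ ε / C * ‖w‖)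
    (fun A A' hAA' ⟨G, hG⟩ => ⟨G, fun w hw j hj =>
      hG w (fun i hi => hw i fun h => hi (hAA' h)) j hj⟩)
    (fun A A' ⟨G, hG⟩ ⟨G', hG'⟩ => ⟨G ∪ G', fun w hw j hj => by
      obtain ⟨v, hv, v', hv', rfl, h1, h2⟩ := exists_add_eq_of_lpSupported_union W A A' w hw
      rw [Finset.mem_union, not_or] at hj
      rw [map_add]
      refine (IsUltrametricDist.norm_add_le_max _ _).trans (max_le ?_ ?_)
      · exact (hG v hv j hj.1).trans (by gcongr)
      · exact (hG' v' hv' j hj.2).trans (by gcongr)⟩)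
    (fun A hA hA0 => exists_tail_forall_norm_le hdense T D
      (fun j w => (norm_subConstRestrict_le p (B j) (b w)).trans (hD w))
      (fun w δ hδ => finite_le_norm_subConstRestrict p B hB (b w) hδ)
      (fun n => lpSupported W (A n)) (fun m n hmn f hf x hx => hf x fun h => hx (hA hmn h))
      (fun M hM x hx r hr hxr => exists_sum_lpSupported W (fun n => A (M n))
        (hA.comp_monotone hM.monotone)
        (fun x => (hA0 x).imp fun n hn h => hn (hA hM.le_apply h)) x hx r hr hxr) hpos)
  -- One basic neighbourhood outside the exceptional set is enough.
  obtain ⟨j, hj⟩ := Infinite.exists_notMem_finset G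
  obtain ⟨U', h1, h2, h3, h4⟩ := OscillationVanishes.sum
    (fun i f => b (lp.single ∞ i (a f i)))
    (fun i => hW i ((lp.evalCLM k (fun i => (W i : Type u)) ∞ i).comp a)
      (b.comp (lp.singleContinuousLinearMap k (fun i => (W i : Type u)) ∞ i))) F ε hε
      (U ∩ interior (B j)) (hU.inter isOpen_interior)
      ⟨p, hp, mem_interior_iff_mem_nhds.mpr (hB.mem j)⟩
  refine ⟨U', fun x hx => (h1 hx).1, h2, h3, fun f hf x hx y hy => ?_⟩
  set w := a f - ∑ i ∈ F, lp.single ∞ i (a f i) with hw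
  have hwn : ‖w‖ ≤ C * ‖f‖ :=
    norm_sub_sum_single_le W _ F (by positivity) fun i _ =>
      (lp.norm_apply_le_norm ENNReal.top_ne_zero _ i).trans (hC f)
  have hTw : ‖T j w‖ ≤ ε * ‖f‖ := by
    refine (hFG w (fun i hi => ?_) j hj).trans ?_
    · rw [hw, sub_sum_single_apply, if_pos (not_not.mp hi)]
    · calc ε / C * ‖w‖ ≤ ε / C * (C * ‖f‖) := by
            gcongr
        _ = ε * ‖f‖ := by field_simp
  have hnear : ∀ z ∈ U', ‖b w z - b w p‖ ≤ ε * ‖f‖ := fun z hz =>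
    ((T j w).norm_coe_le_norm ⟨z, interior_subset (h1 hz).2⟩).trans hTw
  have hsplit : b (a f) = b w + ∑ i ∈ F, b (lp.single ∞ i (a f i)) := by
    rw [hw, map_sub, map_sum, sub_add_cancel]
  beta_reduce
  rw [hsplit, BoundedContinuousFunction.add_apply, BoundedContinuousFunction.add_apply,
    add_sub_add_comm]
  refine (IsUltrametricDist.norm_add_le_max _ _).trans (max_le ?_ (h4 f hf x hx y hy))
  rw [← sub_sub_sub_cancel_right _ _ (b w p)]
  exact (norm_sub_le_max_of_ultrametric _ _).trans (max_le (hnear x hx) (hnear y hy))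

/-! ### The Reid class -/

theorem factorsVanish_of_mem_reidClass [IsUltrametricDist k] [CompleteSpace k] {X : Type}
    [TopologicalSpace X] [FirstCountableTopology X]
    (hdense : Dense (Set.range fun x : k => ‖x‖₊))
    (hX : ∀ U : Set X, IsOpen U → U.Nonempty → ∃ A : ℕ → Set X, Antitone A ∧
      (∀ n, IsClopen (A n)) ∧ (∀ n, (A n).Nonempty) ∧ (∀ n, A n ⊆ U) ∧ ∀ x, ∃ n, x ∉ A n)
    {κ : WithTop Cardinal.{u}} (hmeas : NonMeasurabilityCondition κ) {V : BanachObj k}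
    (hV : V ∈ reidClass k κ) : FactorsVanish X V := by
  obtain ⟨α, hα⟩ := Set.mem_iUnion.mp hV
  clear hV
  induction α using WellFoundedLT.induction generalizing V with
  | ind α ih =>
    rw [reidStage] at hα
    rcases hα with hV | ⟨I, hI, W, hW, h⟩
    · exact factorsVanish_of_mem_finFree hdense hV
    · have hWv : ∀ i, FactorsVanish X (W i) := fun i => by
        obtain ⟨β, hβ, hi⟩ := hW i
        exact ih β hβ hi
      rcases h with h | h
      · exact .of_iso h fun a b => oscillationVanishes_lp hdense (hmeas I hI) W hWv a b
      · exact .of_iso h fun a b => oscillationVanishes_nullSubmodule hdense hX W hWv a b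

end BanachObj

/-! ### The rational numbers -/

theorem Rat.isClopen_setOf_irrational_lt_lt {z z' : ℝ} (hz : Irrational z) (hz' : Irrational z') :
    IsClopen {q : ℚ | z < q ∧ (q : ℝ) < z'} := by
  refine ⟨?_, ?_⟩
  · have : {q : ℚ | z < q ∧ (q : ℝ) < z'} = {q : ℚ | z ≤ q ∧ (q : ℝ) ≤ z'} := by
      ext q
      refine ⟨fun h => ⟨h.1.le, h.2.le⟩, fun h => ⟨h.1.lt_of_ne (hz.ne_rat q), ?_⟩⟩
      exact h.2.lt_of_ne (hz'.ne_rat q).symm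
    rw [this]
    exact (isClosed_le continuous_const Rat.continuous_coe_real).inter
      (isClosed_le Rat.continuous_coe_real continuous_const)
  · exact (isOpen_lt continuous_const Rat.continuous_coe_real).inter
      (isOpen_lt Rat.continuous_coe_real continuous_const)

/-- Intervals shrinking towards an irrational left endpoint `z` have no rational point in common.
Rational lengths keep the right endpoints irrational, hence the intervals clopen in `ℚ`. -/
theorem Rat.exists_antitone_isClopen {U : Set ℚ} (hU : IsOpen U) (hne : U.Nonempty) :
    ∃ A : ℕ → Set ℚ, Antitone A ∧ (∀ n, IsClopen (A n)) ∧ (∀ n, (A n).Nonempty) ∧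
      (∀ n, A n ⊆ U) ∧ ∀ x, ∃ n, x ∉ A n := by
  obtain ⟨p, hp⟩ := hne
  obtain ⟨δ, hδ, hball⟩ := Metric.isOpen_iff.mp hU p hp
  obtain ⟨z, hz, hz1, hz2⟩ := exists_irrational_btwn (show (p : ℝ) < p + δ by linarith)
  obtain ⟨c, hc1, hc2⟩ := exists_rat_btwn (show (0 : ℝ) < p + δ - z by linarith)
  refine ⟨fun n => {q : ℚ | z < q ∧ (q : ℝ) < z + (c / (n + 1) : ℚ)}, fun m n hmn q hq => ?_,
    fun n => Rat.isClopen_setOf_irrational_lt_lt hz (hz.add_ratCast _), fun n => ?_,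
    fun n q hq => hball ?_, fun q => ?_⟩
  · refine ⟨hq.1, hq.2.trans_le ?_⟩
    push_cast
    have : (m : ℝ) ≤ n := by exact_mod_cast hmn
    gcongr
  · refine exists_rat_btwn (lt_add_of_pos_right z ?_)
    push_cast
    positivity
  · have h1 : ((c / (n + 1) : ℚ) : ℝ) ≤ c := by
      push_cast
      exact div_le_self hc1.le (by linarith [n.cast_nonneg (α := ℝ)])
    rw [Metric.mem_ball, Rat.dist_eq, abs_of_pos (by linarith [hq.1])]
    linarith [hq.2]
  · by_cases hq : z < q
    · obtain ⟨n, hn⟩ := exists_nat_gt (c / (q - z) : ℝ)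
      refine ⟨n, fun h => absurd h.2 (not_lt.mpr ?_)⟩
      have hqz : 0 < (q : ℝ) - z := sub_pos.mpr hq
      rw [div_lt_iff₀ hqz] at hn
      have : (c / (n + 1) : ℝ) ≤ q - z := by
        rw [div_le_iff₀ (by positivity)]
        nlinarith
      push_cast
      linarith
    · exact ⟨0, fun h => hq h.1⟩

/-- The indicator of `A n` has norm at most `1` and takes both values `0` and `1` on `U`, which
contradicts oscillation at most `1 / 2`. -/
theorem BanachObj.not_oscillationVanishes_id {k : Type u} [NormedField k] :
    ¬ BanachObj.OscillationVanishes (k := k) (X := ℚ) id := by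
  classical
  intro h
  obtain ⟨U, -, hU, hne, hosc⟩ := h (1 / 2) (by norm_num) Set.univ isOpen_univ Set.univ_nonempty
  obtain ⟨A, -, hA, hAne, hAU, hA0⟩ := Rat.exists_antitone_isClopen hU hne
  obtain ⟨x, hx⟩ := hAne 0
  obtain ⟨n, hn⟩ := hA0 x
  obtain ⟨y, hy⟩ := hAne n
  have hcont : Continuous fun z => if z ∈ A n then (1 : k) else 0 :=
    continuous_const.if (fun z hz => by simp [(hA n).frontier_eq] at hz) continuous_const
  have hle : ∀ z, ‖if z ∈ A n then (1 : k) else 0‖ ≤ 1 := fun z => by split_ifs <;> simp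
  have hmem : BoundedContinuousFunction.ofNormedAddCommGroup _ hcont 1 hle ∈
      BanachObj.bcfSupported k U := fun z hz => if_neg fun h => hz (hAU n h)
  have h1 := hosc _ hmem y (hAU n hy) x (hAU 0 hx)
  have h2 := BoundedContinuousFunction.norm_ofNormedAddCommGroup_le hcont zero_le_one hle
  simp only [id, BoundedContinuousFunction.coe_ofNormedAddCommGroup, hy, hn, if_true, if_false,
    sub_zero, norm_one] at h1
  linarith

theorem mainTheorem5 {k : Type u} [NormedField k] [IsUltrametricDist k] [CompleteSpace k]
    (hdense : Dense (Set.range fun x : k => ‖x‖₊))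
    (κ : WithTop Cardinal.{u}) (hinf : (Cardinal.aleph0 : Cardinal.{u}) ≤ κ)
    (hmeas : NonMeasurabilityCondition κ) :
    BanachObj.Cbd k ℚ ∉ BanachObj.reidClass k κ := by
  intro h
  have hvan : BanachObj.FactorsVanish ℚ (BanachObj.Cbd k ℚ) :=
    BanachObj.factorsVanish_of_mem_reidClass hdense
      (fun U hU hne => Rat.exists_antitone_isClopen hU hne) hmeas h
  -- The identity factors through the space itself.
  exact BanachObj.not_oscillationVanishes_id
    (hvan (ContinuousLinearMap.id k (ℚ →ᵇ k)) (ContinuousLinearMap.id k (ℚ →ᵇ k)))
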